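/- Let $\mathbb H$ be the quaternions with units $i,j,k$, $\mathbb C=\mathbb R+\mathbb R i\subset\mathbb H$, and $s\ge 0$ an integer. A function $r:\mathbb Z\to\mathbb H^{s\times s}$ is called positive definite if for every $N\in\mathbb N$ and all $n_1,\dots,n_N\in\mathbb Z$ the $N\times N$ block matrix with $(j,\ell)$ block $r(n_j-n_\ell)$ is Hermitian and nonnegative, i.e. $c^*Tc\ge 0$ for this matrix $T$ and every $c\in\mathbb H^{Ns}$. Measures on $[0,2\pi]$ are countably additive set functions on the Borel sets of $[0,2\pi]$ with the endpoints $0$ and $2\pi$ identified (that is, of $\mathbb R/2\pi\mathbb Z$), so that $t\mapsto 2\pi-t$ is a well-defined reflection. Every $\mathbb H^{s\times s}$-valued measure $\nu$ can be written uniquely as $\nu=\nu_1+\nu_2 j$ with $\mathbb C^{s\times s}$-valued measures $\nu_1,\nu_2$. The measure $\nu$ is called $q$-positive if the $\mathbb C^{2s\times 2s}$-valued measure $$\mu=\begin{pmatrix}\nu_1&\nu_2\\ \nu_2^*&\nu_3\end{pmatrix},\qquad d\nu_3(t)=d\overline{\nu_1}(2\pi-t)\quad\text{(entrywise conjugate)},$$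 is positive (i.e. $\mu(A)$ is positive semidefinite for every Borel set $A$) and, in addition, $d\nu_2(t)=-d\nu_2(2\pi-t)^T$. Theorem. A function $r:\mathbb Z\to\mathbb H^{s\times s}$ is positive definite if and only if there exists a unique $q$-positive measure $\nu$ on $[0,2\pi]$ such that $$r(n)=\int_0^{2\pi}e^{int}\,d\nu(t),\qquad n\in\mathbb Z .$$ Moreover, if $r$ has such a representation with some $q$-positive measure $\nu$, then $r$ is positive definite (so the representing measure is then automatically unique). -/

import Mathlib

open scoped Quaternion ComplexOrder Matrix
open MeasureTheory

noncomputable section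

namespace QuaternionHerglotz

/-- The interval `[0, 2π]` with its endpoints identified, i.e. `ℝ / 2πℤ`. The reflection
`t ↦ 2π - t` of the interval is negation here. -/
abbrev Circ : Type := AddCircle (2 * Real.pi)

/-- `Mat s` is the space of `s × s` quaternionic matrices. -/
abbrev Mat (s : ℕ) : Type := Matrix (Fin s) (Fin s) ℍ

/-- A (countably additive) measure on `[0, 2π]`, endpoints identified, whose values are
`s × s` quaternionic matrices. -/
abbrev QMeasure (s : ℕ) : Type := VectorMeasure Circ (Mat s)

/-! ### Nonnegative quaternionic matrices and positive definite sequences -/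

/-- A quaternionic matrix `M` is nonnegative if it is Hermitian and the (then automatically real)
number `c* M c` is nonnegative for every quaternionic vector `c`. -/
def QNonneg {ι : Type*} [Fintype ι] (M : Matrix ι ι ℍ) : Prop :=
  M.IsHermitian ∧ ∀ c : ι → ℍ, 0 ≤ (star c ⬝ᵥ (M *ᵥ c)).re

/-- The block matrix whose `(j, l)` block is `r (n j - n l)`. -/
def blockToeplitz {s : ℕ} (r : ℤ → Mat s) {N : ℕ} (n : Fin N → ℤ) :
    Matrix (Fin N × Fin s) (Fin N × Fin s) ℍ :=
  Matrix.of fun p q => r (n p.1 - n q.1) p.2 q.2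

/-- Positive definiteness of a sequence of quaternionic matrices indexed by `ℤ`. -/
def IsPositiveDefinite {s : ℕ} (r : ℤ → Mat s) : Prop :=
  ∀ (N : ℕ) (n : Fin N → ℤ), QNonneg (blockToeplitz r n)

/-! ### The decomposition `P = P₁ + P₂ j` -/

/-- The complex number `q₁` in `q = q₁ + q₂ j`. -/
def fstComplex (q : ℍ) : ℂ := ⟨q.re, q.imI⟩

/-- The complex number `q₂` in `q = q₁ + q₂ j`. -/
def sndComplex (q : ℍ) : ℂ := ⟨q.imJ, q.imK⟩

/-- The quaternion unit `j`. -/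
def unitJ : ℍ := ⟨0, 0, 1, 0⟩

theorem fst_add_snd_mul_j (q : ℍ) :
    (fstComplex q : ℍ) + (sndComplex q : ℍ) * unitJ = q := by
  have h0 : unitJ.re = 0 := rfl
  have h1 : unitJ.imI = 0 := rfl
  have h2 : unitJ.imJ = 1 := rfl
  have h3 : unitJ.imK = 0 := rfl
  ext <;> simp [Quaternion.re_mul, Quaternion.imI_mul, Quaternion.imJ_mul, Quaternion.imK_mul,
    fstComplex, sndComplex, h0, h1, h2, h3]

/-- The complex matrix measure `ν₁` in `ν = ν₁ + ν₂ j`, evaluated at a set. -/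
def fstPart {s : ℕ} (ν : QMeasure s) (A : Set Circ) : Matrix (Fin s) (Fin s) ℂ :=
  (ν A).map fstComplex

/-- The complex matrix measure `ν₂` in `ν = ν₁ + ν₂ j`, evaluated at a set. -/
def sndPart {s : ℕ} (ν : QMeasure s) (A : Set Circ) : Matrix (Fin s) (Fin s) ℂ :=
  (ν A).map sndComplex

/-- The image of a set under the reflection `t ↦ 2π - t`. -/
def reflect (A : Set Circ) : Set Circ := (fun t => -t) '' A

/-- The `2s × 2s` complex matrix measure with blocks `ν₁`, `ν₂`, `ν₂*`, `ν₃`, where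
`dν₃(t)` is the entrywise conjugate of `dν₁(2π - t)`. -/
def doubled {s : ℕ} (ν : QMeasure s) (A : Set Circ) :
    Matrix (Fin s ⊕ Fin s) (Fin s ⊕ Fin s) ℂ :=
  Matrix.fromBlocks (fstPart ν A) (sndPart ν A)
    (sndPart ν A)ᴴ ((fstPart ν (reflect A)).map star)

/-- `ν` is q-positive: the doubled measure has positive semidefinite values, and
`dν₂(t) = -dν₂(2π - t)ᵀ`. -/
structure QPositive {s : ℕ} (ν : QMeasure s) : Prop where
  posSemidef : ∀ A : Set Circ, MeasurableSet A → (doubled ν A).PosSemidef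
  antisymm : ∀ A : Set Circ, MeasurableSet A → sndPart ν A = -(sndPart ν (reflect A))ᵀ

/-! ### Fourier coefficients of a quaternionic matrix measure -/

/-- The function `t ↦ e^{int}`, with values in `ℂ ⊆ ℍ`. -/
def expInt (n : ℤ) (t : Circ) : ℍ := ((fourier n t : ℂ) : ℍ)

theorem expInt_coe (n : ℤ) (t : ℝ) :
    expInt n (t : Circ) = ((Complex.exp (Complex.I * n * t) : ℂ) : ℍ) := by
  have hpi : (Real.pi : ℂ) ≠ 0 := by exact_mod_cast Real.pi_ne_zero
  unfold expInt
  rw [fourier_coe_apply]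
  congr 2
  push_cast
  field_simp

/-- The quaternion-valued measure formed by the `(k, l)` entries of the values of `ν`. -/
def entry {s : ℕ} (ν : QMeasure s) (k l : Fin s) : VectorMeasure Circ ℍ :=
  ν.mapRange (Matrix.entryAddMonoidHom ℍ k l) (continuous_id.matrix_elem k l)

/-- The function `e^{int}` is integrable against every such measure, so that the integrals below
never take a default value. -/
theorem integrable_expInt {s : ℕ} (ν : QMeasure s) (k l : Fin s) (n : ℤ) :
    (entry ν k l).Integrable (expInt n) := by
  have hfin : IsFiniteMeasure (entry ν k l).variation := by
    let re : ℍ →+ ℝ := ⟨⟨fun q => q.re, rfl⟩, fun _ _ => rfl⟩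
    let cI : ℍ →+ ℝ := ⟨⟨fun q => q.imI, rfl⟩, fun _ _ => rfl⟩
    let cJ : ℍ →+ ℝ := ⟨⟨fun q => q.imJ, rfl⟩, fun _ _ => rfl⟩
    let cK : ℍ →+ ℝ := ⟨⟨fun q => q.imK, rfl⟩, fun _ _ => rfl⟩
    let m1 : SignedMeasure Circ := (entry ν k l).mapRange re Quaternion.continuous_re
    let m2 : SignedMeasure Circ := (entry ν k l).mapRange cI Quaternion.continuous_imI
    let m3 : SignedMeasure Circ := (entry ν k l).mapRange cJ Quaternion.continuous_imJ
    let m4 : SignedMeasure Circ := (entry ν k l).mapRange cK Quaternion.continuous_imK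
    refine isFiniteMeasure_of_le
      (m1.totalVariation + m2.totalVariation + m3.totalVariation + m4.totalVariation)
      (VectorMeasure.variation_le_of_forall_enorm_le fun A _ => ?_)
    have key : ∀ q : ℍ, ‖q‖ₑ ≤ ‖q.re‖ₑ + ‖q.imI‖ₑ + ‖q.imJ‖ₑ + ‖q.imK‖ₑ := by
      intro q
      have h : ‖q‖ ≤ ‖q.re‖ + ‖q.imI‖ + ‖q.imJ‖ + ‖q.imK‖ := by
        have hq := Quaternion.normSq_eq_norm_mul_self q
        rw [Quaternion.normSq_def'] at hq
        simp only [Real.norm_eq_abs]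
        refine abs_le_of_sq_le_sq' ?_ (by positivity) |>.2
        have e1 := sq_abs q.re
        have e2 := sq_abs q.imI
        have e3 := sq_abs q.imJ
        have e4 := sq_abs q.imK
        have a1 := abs_nonneg q.re
        have a2 := abs_nonneg q.imI
        have a3 := abs_nonneg q.imJ
        have a4 := abs_nonneg q.imK
        nlinarith [mul_nonneg a1 a2, mul_nonneg a1 a3, mul_nonneg a1 a4, mul_nonneg a2 a3,
          mul_nonneg a2 a4, mul_nonneg a3 a4]
      simp only [← ofReal_norm]
      rw [← ENNReal.ofReal_add (by positivity) (by positivity),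
        ← ENNReal.ofReal_add (by positivity) (by positivity),
        ← ENNReal.ofReal_add (by positivity) (by positivity)]
      exact ENNReal.ofReal_le_ofReal h
    refine (key _).trans ?_
    simp only [Measure.add_apply]
    exact add_le_add (add_le_add (add_le_add (m1.enorm_le_totalVariation A)
      (m2.enorm_le_totalVariation A)) (m3.enorm_le_totalVariation A))
      (m4.enorm_le_totalVariation A)
  have hco : Continuous (Quaternion.ofComplex : ℂ → ℍ) :=
    LinearMap.continuous_of_finiteDimensional Quaternion.ofComplex.toLinearMap
  have hc : Continuous (expInt n) := hco.comp (fourier n).continuous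
  refine Integrable.of_bound hc.aestronglyMeasurable 1 (Filter.Eventually.of_forall fun t => ?_)
  have hf : ‖(fourier n t : ℂ)‖ = 1 := by rw [fourier_apply]; exact Circle.norm_coe _
  have hn : ∀ z : ℂ, ‖(z : ℍ)‖ = ‖z‖ := by
    intro z
    have h := Quaternion.normSq_eq_norm_mul_self (z : ℍ)
    rw [Quaternion.normSq_def'] at h
    have h2 := Complex.normSq_eq_norm_sq z
    rw [Complex.normSq_apply] at h2
    simp only [Quaternion.re_coeComplex, Quaternion.imI_coeComplex, Quaternion.imJ_coeComplex,
      Quaternion.imK_coeComplex] at h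
    nlinarith [norm_nonneg z, norm_nonneg (z : ℍ)]
  exact ((hn _).trans hf).le

/-- The matrix `∫ e^{int} dν(t)`, computed entrywise, the scalar function standing on the left of
the measure as in the bilinear pairing `(x, y) ↦ x * y` of `ℍ`. -/
def integralExp {s : ℕ} (ν : QMeasure s) (n : ℤ) : Mat s :=
  Matrix.of fun k l => (entry ν k l).integral (expInt n) (ContinuousLinearMap.mul ℝ ℍ)

/-- `r(n) = ∫ e^{int} dν(t)` for a q-positive measure `ν`. -/
def Represents {s : ℕ} (ν : QMeasure s) (r : ℤ → Mat s) : Prop :=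
  QPositive ν ∧ ∀ n : ℤ, r n = integralExp ν n

end QuaternionHerglotz

end

open scoped Quaternion ComplexOrder Matrix
open MeasureTheory

noncomputable section

namespace QuaternionHerglotz

open Filter Topology

/-! Everything is reduced to scalar measures. Replace a quaternionic matrix `X = X₁ + X₂ j` by the
complex matrix `complexRep X` with blocks `X₁`, `X₂`, `-X̄₂`, `X̄₁`; quaternionic positive
definiteness of `r` becomes complex positive definiteness of `R(n) = complexRep (r n)`
(`isPositiveDefinite_iff`). The two conditions in q-positivity say that the doubled measure `μ` is
positive and make its Fourier coefficients exactly `R(n)` (`tendsto_sum_doubled`).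

A q-positive measure gives a positive definite sequence, because each Riemann sum of the Toeplitz
form is a sum of forms of the matrices `μ(A)`. It is unique, because each finite positive measure
`v* μ v` is determined by its Fourier coefficients `v* R(n) v`, and these forms determine `μ`.

For existence, the scalar Herglotz theorem yields for each `v` a measure `μ_v` with coefficients `v*
R(n) v`. Polarization assembles the `μ_v` into a matrix measure. By uniqueness of Fourier
coefficients its form at `v` really is `μ_v` (`quadForm_polarMeasure`), and it inherits the symmetry
of `R(n)` (`polarMeasure_reflect`), so its upper blocks define a q-positive measure whose double it
is. -/

/-! ### Finite measures and their Fourier coefficients -/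

/-- A signed combination of finite measures that annihilates all bounded continuous functions
vanishes. -/
theorem sum_mul_measureReal_eq_zero {X ι : Type*} [TopologicalSpace X] [MeasurableSpace X]
    [BorelSpace X] [HasOuterApproxClosed X] [Fintype ι] (μ : ι → Measure X)
    [∀ i, IsFiniteMeasure (μ i)] (a : ι → ℝ)
    (h : ∀ f : BoundedContinuousFunction X ℝ, ∑ i, a i * ∫ x, f x ∂(μ i) = 0)
    (A : Set X) : ∑ i, a i * (μ i).real A = 0 := by
  have hdiff : ∀ i, ((a i).toNNReal : ℝ) - ((-a i).toNNReal : ℝ) = a i := fun i => by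
    rw [Real.coe_toNNReal', Real.coe_toNNReal']
    exact max_zero_sub_eq_self (a i)
  have hint : ∀ (f : BoundedContinuousFunction X ℝ) (b : ι → NNReal),
      ∫ x, f x ∂(∑ i, b i • μ i) = ∑ i, (b i : ℝ) * ∫ x, f x ∂(μ i) := fun f b => by
    rw [integral_finsetSum_measure fun i _ => (f.integrable (μ i)).smul_measure_nnreal]
    refine Finset.sum_congr rfl fun i _ => ?_
    rw [integral_smul_nnreal_measure]
    rfl
  have hreal : ∀ b : ι → NNReal, (∑ i, b i • μ i).real A = ∑ i, (b i : ℝ) * (μ i).real A :=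
    fun b => by
    rw [Measure.real, Measure.finsetSum_apply, ENNReal.toReal_sum fun i _ => measure_ne_top _ _]
    exact Finset.sum_congr rfl fun i _ => measureReal_nnreal_smul_apply _
  -- Moving the negative coefficients to the other side leaves an identity between two finite
  -- positive measures, which bounded continuous functions separate.
  have heq : (∑ i, (a i).toNNReal • μ i) = ∑ i, (-a i).toNNReal • μ i := by
    refine ext_of_forall_integral_eq_of_IsFiniteMeasure fun f => ?_
    rw [hint, hint, ← sub_eq_zero, ← Finset.sum_sub_distrib, ← h f]
    exact Finset.sum_congr rfl fun i _ => by rw [← sub_mul, hdiff]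
  have := hreal fun i => (a i).toNNReal
  rw [heq, hreal, ← sub_eq_zero, ← Finset.sum_sub_distrib] at this
  rw [← neg_eq_zero, ← this, ← Finset.sum_neg_distrib]
  exact Finset.sum_congr rfl fun i _ => by rw [← sub_mul, ← neg_sub, hdiff, neg_mul]

/-- Integration of continuous functions against a finite measure. -/
def integralContinuous {X : Type*} [TopologicalSpace X] [CompactSpace X] [MeasurableSpace X]
    [BorelSpace X] (μ : Measure X) [IsFiniteMeasure μ] : C(X, ℂ) →L[ℂ] ℂ :=
  have hi : ∀ f : C(X, ℂ), Integrable f μ := fun f =>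
    f.continuous.integrable_of_hasCompactSupport (HasCompactSupport.of_compactSpace f)
  LinearMap.mkContinuous
    { toFun := fun f => ∫ x, f x ∂μ
      map_add' := fun f g => integral_add (hi f) (hi g)
      map_smul' := fun c f => integral_const_mul c _ } (μ.real Set.univ) fun f => by
    rw [mul_comm]
    exact norm_integral_le_of_norm_le_const (Filter.Eventually.of_forall f.norm_coe_le_norm)

/-- A complex combination of finite measures on the circle whose Fourier coefficients vanish is
zero. -/
theorem sum_mul_measureReal_eq_zero_of_fourier {T : ℝ} [Fact (0 < T)] {ι : Type*} [Fintype ι]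
    (μ : ι → Measure (AddCircle T)) [∀ i, IsFiniteMeasure (μ i)] (c : ι → ℂ)
    (h : ∀ n : ℤ, ∑ i, c i * ∫ t, fourier n t ∂(μ i) = 0) (A : Set (AddCircle T)) :
    ∑ i, c i * ((μ i).real A : ℂ) = 0 := by
  let Φ : C(AddCircle T, ℂ) →L[ℂ] ℂ := ∑ i, c i • integralContinuous (μ i)
  have hΦ : ∀ f, Φ f = ∑ i, c i * ∫ t, f t ∂(μ i) := fun f => by
    simp [Φ, integralContinuous]
  -- A continuous functional killed by all characters vanishes, since trigonometric polynomials are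
  -- dense.
  have hzero : Φ = 0 := by
    refine ContinuousLinearMap.ext_on
      ((Submodule.dense_iff_topologicalClosure_eq_top).2 span_fourier_closure_eq_top) ?_
    rintro _ ⟨n, rfl⟩
    rw [hΦ, h n]
    rfl
  -- Real test functions have real integrals, so the real and imaginary parts of the coefficients
  -- decouple.
  have hreal : ∀ f : BoundedContinuousFunction (AddCircle T) ℝ,
      ∑ i, c i * ((∫ t, f t ∂(μ i) : ℝ) : ℂ) = 0 := fun f => by
    have := hΦ ⟨fun t => (f t : ℂ), by fun_prop⟩
    rw [hzero] at this
    simpa [integral_complex_ofReal] using this.symm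
  apply Complex.ext
  · simpa using sum_mul_measureReal_eq_zero μ (fun i => (c i).re)
      (fun f => by simpa using congrArg Complex.re (hreal f)) A
  · simpa using sum_mul_measureReal_eq_zero μ (fun i => (c i).im)
      (fun f => by simpa using congrArg Complex.im (hreal f)) A

/-- Finite measures on the circle are determined by their Fourier coefficients. -/
theorem measureReal_eq_of_fourier {T : ℝ} [Fact (0 < T)] (μ ν : Measure (AddCircle T))
    [IsFiniteMeasure μ] [IsFiniteMeasure ν]
    (h : ∀ n : ℤ, ∫ t, fourier n t ∂μ = ∫ t, fourier n t ∂ν) (A : Set (AddCircle T)) :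
    μ.real A = ν.real A := by
  have : ∀ i : Bool, IsFiniteMeasure (bif i then μ else ν) := fun i => by
    cases i <;> assumption
  have := sum_mul_measureReal_eq_zero_of_fourier (fun i : Bool => bif i then μ else ν)
    (fun i => bif i then 1 else -1) (fun n => by simp [-fourier_apply, h n]) A
  simp only [Fintype.sum_bool, cond_true, cond_false, one_mul, neg_mul, ← sub_eq_add_neg,
    sub_eq_zero] at this
  exact_mod_cast this

/-! ### The scalar Herglotz theorem by Fejér means -/

/-- The Fejér kernel form `N⁻¹ ∑_{j,l < N} u(j - l) e^{-i(j-l)t}` of a sequence `u`. -/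
def fejerSum {T : ℝ} (u : ℤ → ℂ) (N : ℕ) (t : AddCircle T) : ℂ :=
  (N : ℂ)⁻¹ * ∑ j : Fin N, ∑ l : Fin N, u ((j : ℤ) - l) * fourier (-((j : ℤ) - l)) t

theorem continuous_fejerSum {T : ℝ} (u : ℤ → ℂ) (N : ℕ) :
    Continuous (fejerSum (T := T) u N) := by
  unfold fejerSum
  fun_prop

/-- For `n ≠ 0` a suitable translation changes the sign of the character but preserves Haar measure.
-/
theorem integral_fourier_haar {T : ℝ} [hT : Fact (0 < T)] (n : ℤ) :
    ∫ t : AddCircle T, fourier n t ∂AddCircle.haarAddCircle = if n = 0 then 1 else 0 := by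
  split_ifs with h
  · simp [h]
  · exact integral_eq_zero_of_add_right_eq_neg (fourier_add_half_inv_index h hT.elim)

theorem sum_ite_eq_add (N k : ℕ) :
    ∑ j : Fin N, ∑ l : Fin N, (if (j : ℕ) = l + k then (1 : ℝ) else 0) = max 0 (N - k : ℝ) := by
  rw [Finset.sum_comm, Finset.sum_range
    (f := fun l => ∑ j : Fin N, (if (j : ℕ) = l + k then (1 : ℝ) else 0)) |>.symm]
  have h1 : ∀ l, ∑ j : Fin N, (if (j : ℕ) = l + k then (1 : ℝ) else 0)
      = if l < N - k then 1 else 0 := fun l => by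
    rw [Finset.sum_range (f := fun j => (if j = l + k then (1 : ℝ) else 0)) |>.symm,
      Finset.sum_ite_eq']
    exact if_congr (by rw [Finset.mem_range]; omega) rfl rfl
  simp_rw [h1]
  rw [← Finset.sum_filter, Finset.sum_const, nsmul_one,
    show (Finset.range N).filter (· < N - k) = Finset.range (N - k) by ext; simp; omega,
    Finset.card_range]
  rcases le_total k N with h | h
  · rw [Nat.cast_sub h, max_eq_right (sub_nonneg.2 (by exact_mod_cast h))]
  · rw [Nat.sub_eq_zero_of_le h, max_eq_left (sub_nonpos.2 (by exact_mod_cast h)), Nat.cast_zero]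

/-- The number of pairs in `{0, …, N-1}²` whose difference is `n`. -/
theorem sum_ite_eq_sub (N : ℕ) (n : ℤ) :
    ∑ j : Fin N, ∑ l : Fin N, (if (n : ℤ) = (j : ℤ) - l then (1 : ℝ) else 0)
      = max 0 (N - |n| : ℝ) := by
  obtain ⟨k, rfl | rfl⟩ := n.eq_nat_or_neg
  · rw [Nat.abs_cast, Int.cast_natCast, ← sum_ite_eq_add]
    exact Finset.sum_congr rfl fun j _ => Finset.sum_congr rfl fun l _ =>
      if_congr (by omega) rfl rfl
  · rw [abs_neg, Nat.abs_cast, Int.cast_natCast, ← sum_ite_eq_add,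
      Finset.sum_comm]
    exact Finset.sum_congr rfl fun j _ => Finset.sum_congr rfl fun l _ =>
      if_congr (by omega) rfl rfl

/-- Orthogonality keeps only the pairs with `j - l = n`; counting them gives the Fejér weight. For
`N = 0` both sides vanish because `0⁻¹ = 0`. -/
theorem integral_fourier_mul_fejerSum {T : ℝ} [Fact (0 < T)] (u : ℤ → ℂ) (N : ℕ) (n : ℤ) :
    ∫ t : AddCircle T, fourier n t * fejerSum u N t ∂AddCircle.haarAddCircle
      = (((N : ℝ)⁻¹ * max 0 (N - |n| : ℝ) : ℝ) : ℂ) * u n := by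
  have hterm : ∀ j l : Fin N,
      ∫ t : AddCircle T, fourier n t * (u ((j : ℤ) - l) * fourier (-((j : ℤ) - l)) t)
        ∂AddCircle.haarAddCircle = (if (n : ℤ) = (j : ℤ) - l then (1 : ℝ) else 0 : ℝ) * u n := fun j l => by
    have : ∀ t : AddCircle T, fourier n t * (u ((j : ℤ) - l) * fourier (-((j : ℤ) - l)) t)
        = u ((j : ℤ) - l) * fourier (n - ((j : ℤ) - l)) t := fun t => by
      rw [sub_eq_add_neg n, fourier_add]; ring
    simp_rw [this]
    rw [integral_const_mul, integral_fourier_haar]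
    by_cases h : n = (j : ℤ) - l
    · rw [if_pos (sub_eq_zero.2 h), if_pos h, ← h]; simp
    · rw [if_neg (fun h' => h (sub_eq_zero.1 h')), if_neg h]; simp
  have hexp : ∀ t : AddCircle T, fourier n t * fejerSum u N t = (N : ℂ)⁻¹ *
      ∑ j : Fin N, ∑ l : Fin N, fourier n t * (u ((j : ℤ) - l) * fourier (-((j : ℤ) - l)) t) :=
    fun t => by
    simp only [fejerSum, ← Finset.mul_sum]; ring
  have hi : ∀ j l : Fin N, Integrable (fun t : AddCircle T =>
      fourier n t * (u ((j : ℤ) - l) * fourier (-((j : ℤ) - l)) t)) AddCircle.haarAddCircle := fun j l =>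
    Continuous.integrable_of_hasCompactSupport (by fun_prop) (HasCompactSupport.of_compactSpace _)
  simp_rw [hexp]
  rw [integral_const_mul, integral_finsetSum _ fun j _ => integrable_finsetSum _ fun l _ => hi j l]
  simp_rw [integral_finsetSum _ fun l _ => hi _ l, hterm]
  rw [← sum_ite_eq_sub]
  push_cast
  simp only [← Finset.sum_mul]
  ring

/-- **Herglotz's theorem** (existence): a positive definite sequence of complex numbers is the
sequence of Fourier coefficients of a finite measure on the circle. -/
theorem exists_measure_integral_fourier_eq {T : ℝ} [Fact (0 < T)] (u : ℤ → ℂ)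
    (hu : ∀ n, u (-n) = star (u n))
    (hpos : ∀ (N : ℕ) (c : Fin N → ℂ),
      0 ≤ (∑ j : Fin N, ∑ l : Fin N, star (c j) * u ((j : ℤ) - l) * c l).re) :
    ∃ μ : Measure (AddCircle T), IsFiniteMeasure μ ∧ ∀ n, ∫ t, fourier n t ∂μ = u n := by
  have him : ∀ N (t : AddCircle T), (fejerSum u N t).im = 0 := fun N t => by
    rw [← Complex.conj_eq_iff_im]
    simp only [fejerSum, map_mul, map_sum, map_inv₀, Complex.conj_natCast]
    rw [Finset.sum_comm]
    congr 1
    refine Finset.sum_congr rfl fun j _ => Finset.sum_congr rfl fun l _ => ?_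
    rw [← fourier_neg, ← neg_sub (j : ℤ) (l : ℤ), hu]
    simp
  -- The Fejér sum is `N⁻¹` times the Toeplitz form at the vector `c_j = e_j(t)` of characters.
  have hre : ∀ N (t : AddCircle T), 0 ≤ (fejerSum u N t).re := fun N t => by
    have h := hpos N fun j => fourier (j : ℤ) t
    have e : fejerSum u N t = ((N : ℝ)⁻¹ : ℝ) * ∑ j : Fin N, ∑ l : Fin N,
        star (fourier (j : ℤ) t : ℂ) * u ((j : ℤ) - l) * fourier (l : ℤ) t := by
      rw [fejerSum]
      push_cast
      congr 1
      refine Finset.sum_congr rfl fun j _ => Finset.sum_congr rfl fun l _ => ?_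
      rw [neg_sub, sub_eq_add_neg (l : ℤ), fourier_add, fourier_neg, Complex.star_def]
      ring
    rw [e, Complex.re_ofReal_mul]
    positivity
  have hcoe : ∀ N (t : AddCircle T), fejerSum u N t = ((fejerSum u N t).re : ℂ) := fun N t =>
    Complex.ext rfl (him N t)
  let σ : ℕ → AddCircle T → NNReal := fun N t => (fejerSum u N t).re.toNNReal
  have hσc : ∀ N, Continuous (σ N) := fun N =>
    continuous_real_toNNReal.comp (Complex.continuous_re.comp (continuous_fejerSum u N))
  let m : ℕ → Measure (AddCircle T) := fun N => AddCircle.haarAddCircle.withDensity fun t => (σ N t : ENNReal)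
  have hm : ∀ N n, ∫ t, fourier n t ∂(m N) = (((N : ℝ)⁻¹ * max 0 (N - |n| : ℝ) : ℝ) : ℂ) * u n :=
    fun N n => by
    rw [← integral_fourier_mul_fejerSum (T := T),
      integral_withDensity_eq_integral_smul (hσc N).measurable]
    refine integral_congr_ae (Eventually.of_forall fun t => ?_)
    change ((σ N t : ℝ) : ℂ) * _ = _
    rw [mul_comm]
    beta_reduce
    rw [hcoe N t, Real.coe_toNNReal _ (hre N t)]
  have hfin : ∀ N, IsFiniteMeasure (m N) := fun N =>
    isFiniteMeasure_withDensity_ofReal (((Complex.continuous_re.comp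
      (continuous_fejerSum u N)).integrable_of_hasCompactSupport
        (HasCompactSupport.of_compactSpace _)).hasFiniteIntegral)
  have hu0 : 0 ≤ (u 0).re := by simpa using hpos 1 fun _ => 1
  -- The mass is the zeroth Fourier coefficient; `N⁻¹ * N ≤ 1` also covers `N = 0`.
  have hmass : ∀ N, (m N).real Set.univ ≤ (u 0).re := fun N => by
    have h := hm N 0
    simp only [fourier_zero, integral_const, Int.cast_zero, abs_zero, sub_zero] at h
    have h' := congrArg Complex.re h
    rw [Complex.re_ofReal_mul, max_eq_right (Nat.cast_nonneg N)] at h'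
    simp only [Complex.real_smul, mul_one, Complex.ofReal_re] at h'
    rw [h']
    exact mul_le_of_le_one_left hu0 inv_mul_le_one
  let M : ℕ → FiniteMeasure (AddCircle T) := fun N => ⟨m N, hfin N⟩
  -- Finite measures of bounded mass on a compact space are weakly compact; a limit along an
  -- ultrafilter replaces the choice of a subsequence.
  obtain ⟨μ, -, hμ⟩ := (isCompact_setOfPred_finiteMeasure_le_of_compactSpace (AddCircle T)
    (u 0).re.toNNReal).ultrafilter_le_nhds ((hyperfilter ℕ : Ultrafilter ℕ).map M) (by
      rw [le_principal_iff, Ultrafilter.coe_map]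
      refine mem_map.2 (Filter.Eventually.of_forall fun N => ?_)
      exact NNReal.le_toNNReal_of_coe_le (hmass N))
  refine ⟨μ, inferInstance, fun n => ?_⟩
  have h1 := (FiniteMeasure.tendsto_iff_forall_integral_rclike_tendsto ℂ).1
    (show Tendsto M (hyperfilter ℕ) (𝓝 μ) from hμ)
    (BoundedContinuousFunction.mkOfCompact (fourier n))
  have h2 : Tendsto (fun N : ℕ => (N : ℝ)⁻¹ * max 0 (N - |n| : ℝ)) atTop (𝓝 1) := by
    have h3 : Tendsto (fun N : ℕ => 1 - ((|n| : ℤ) : ℝ) * (N : ℝ)⁻¹) atTop (𝓝 (1 - ((|n| : ℤ) : ℝ) * 0)) :=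
      tendsto_const_nhds.sub (tendsto_inv_atTop_nhds_zero_nat.const_mul _)
    rw [mul_zero, sub_zero] at h3
    refine h3.congr' ?_
    filter_upwards [eventually_ge_atTop (n.natAbs + 1)] with N hN
    have hN' : ((|n| : ℤ) : ℝ) ≤ N := by
      rw [Int.abs_eq_natAbs, Int.cast_natCast]
      exact_mod_cast (Nat.le_succ _).trans hN
    have hN0 : (N : ℝ) ≠ 0 := by
      have : N ≠ 0 := by omega
      exact_mod_cast this
    rw [max_eq_right (sub_nonneg.2 hN'), mul_sub, inv_mul_cancel₀ hN0, mul_comm]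
  have h4 : Tendsto (fun N => ∫ t, fourier n t ∂(m N)) atTop (𝓝 (u n)) := by
    simp_rw [hm]
    simpa using ((Complex.continuous_ofReal.tendsto 1).comp h2).mul_const (u n)
  exact tendsto_nhds_unique h1 (h4.mono_left Nat.hyperfilter_le_atTop)

/-! ### Quadratic forms of complex matrices -/

/-- The quadratic form `v* M v`. -/
def quadForm {ι : Type*} [Fintype ι] (v : ι → ℂ) : Matrix ι ι ℂ →ₗ[ℂ] ℂ where
  toFun M := star v ⬝ᵥ M *ᵥ v
  map_add' M N := by rw [Matrix.add_mulVec, dotProduct_add]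
  map_smul' c M := by rw [Matrix.smul_mulVec, dotProduct_smul, RingHom.id_apply]

theorem quadForm_apply {ι : Type*} [Fintype ι] (v : ι → ℂ) (M : Matrix ι ι ℂ) :
    quadForm v M = star v ⬝ᵥ M *ᵥ v := rfl

theorem quadForm_eq_sum {ι : Type*} [Fintype ι] (v : ι → ℂ) (M : Matrix ι ι ℂ) :
    quadForm v M = ∑ a, ∑ b, star (v a) * v b * M a b := by
  simp only [quadForm_apply, dotProduct, Matrix.mulVec, Finset.mul_sum, Pi.star_apply]
  exact Finset.sum_congr rfl fun a _ => Finset.sum_congr rfl fun b _ => by ring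

theorem quadForm_conjTranspose {ι : Type*} [Fintype ι] (v : ι → ℂ) (M : Matrix ι ι ℂ) :
    quadForm v Mᴴ = star (quadForm v M) := by
  rw [quadForm_eq_sum, quadForm_eq_sum, Finset.sum_comm]
  simp only [star_sum, star_mul', star_star, Matrix.conjTranspose_apply]
  exact Finset.sum_congr rfl fun a _ => Finset.sum_congr rfl fun b _ => by ring

/-- The vector `e_a + i^k e_b`. -/
def polarVector {ι : Type*} [DecidableEq ι] (a b : ι) (k : Fin 4) : ι → ℂ :=
  Pi.single a 1 + Pi.single b (Complex.I ^ (k : ℕ))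

/-- The coefficient `(-i)^k / 4` of the polarization identity. -/
def polarCoeff (k : Fin 4) : ℂ := (-Complex.I) ^ (k : ℕ) / 4

/-- The matrix of a quadratic form, computed by polarization. -/
def polarize {ι : Type*} [DecidableEq ι] (f : (ι → ℂ) → ℂ) : Matrix ι ι ℂ :=
  Matrix.of fun a b => ∑ k, polarCoeff k * f (polarVector a b k)

theorem quadForm_polarVector {ι : Type*} [Fintype ι] [DecidableEq ι] (M : Matrix ι ι ℂ) (a b : ι)
    (k : Fin 4) : quadForm (polarVector a b k) M = M a a + Complex.I ^ (k : ℕ) * M a b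
      + (-Complex.I) ^ (k : ℕ) * M b a + M b b := by
  have h : (-Complex.I) ^ (k : ℕ) * Complex.I ^ (k : ℕ) = 1 := by
    rw [← mul_pow]; simp
  have hs : star (polarVector a b k) = Pi.single a 1 + Pi.single b ((-Complex.I) ^ (k : ℕ)) := by
    simp [polarVector]
  rw [quadForm_apply, hs, polarVector]
  simp only [Matrix.mulVec_add, dotProduct_add, add_dotProduct, Matrix.mulVec_single,
    single_dotProduct, Pi.smul_apply, Matrix.col_apply, MulOpposite.smul_eq_mul_unop,
    MulOpposite.unop_op]
  linear_combination M b b * h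

/-- After multiplication by `(-i)^k`, only the `M a b` term is constant in `k`; the others carry
`(-i)^k` or `(-1)^k`, which sum to zero. -/
theorem polarize_quadForm {ι : Type*} [Fintype ι] [DecidableEq ι] (M : Matrix ι ι ℂ) :
    polarize (fun v => quadForm v M) = M := by
  ext a b
  have h3 : Complex.I ^ 3 = -Complex.I := by rw [pow_succ, Complex.I_sq]; ring
  have h6 : Complex.I ^ 6 = -1 := by rw [show 6 = 2 * 3 from rfl, pow_mul, Complex.I_sq]; ring
  simp only [polarize, Matrix.of_apply, quadForm_polarVector, polarCoeff, Fin.sum_univ_four,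
    Fin.val_zero, Fin.val_one, Fin.val_two, pow_zero, pow_one,
    show ((3 : Fin 4) : ℕ) = 3 from rfl]
  ring_nf
  simp only [Complex.I_sq, Complex.I_pow_four, h3, h6]
  ring

theorem ext_quadForm {ι : Type*} [Fintype ι] [DecidableEq ι] {M N : Matrix ι ι ℂ}
    (h : ∀ v, quadForm v M = quadForm v N) : M = N := by
  rw [← polarize_quadForm M, ← polarize_quadForm N, funext h]

/-- Over `ℂ` a form with real values already forces `M` to be Hermitian, by polarization. -/
theorem posSemidef_of_quadForm {ι : Type*} [Fintype ι] [DecidableEq ι] {M : Matrix ι ι ℂ}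
    (h : ∀ v, 0 ≤ quadForm v M) : M.PosSemidef := by
  refine Matrix.PosSemidef.of_dotProduct_mulVec_nonneg (ext_quadForm fun v => ?_) h
  rw [quadForm_conjTranspose]
  exact Complex.conj_eq_iff_im.2 (Complex.nonneg_iff.1 (h v)).2.symm

/-! ### The complex representation of quaternionic matrices -/

@[simp] theorem fstComplex_zero : fstComplex 0 = 0 := rfl

@[simp] theorem sndComplex_zero : sndComplex 0 = 0 := rfl

theorem fstComplex_add (p q : ℍ) : fstComplex (p + q) = fstComplex p + fstComplex q := by
  apply Complex.ext <;> simp [fstComplex]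

theorem sndComplex_add (p q : ℍ) : sndComplex (p + q) = sndComplex p + sndComplex q := by
  apply Complex.ext <;> simp [sndComplex]

theorem fstComplex_sum {ι : Type*} (S : Finset ι) (f : ι → ℍ) :
    fstComplex (∑ p ∈ S, f p) = ∑ p ∈ S, fstComplex (f p) :=
  map_sum (⟨⟨fstComplex, rfl⟩, fstComplex_add⟩ : ℍ →+ ℂ) f S

theorem sndComplex_sum {ι : Type*} (S : Finset ι) (f : ι → ℍ) :
    sndComplex (∑ p ∈ S, f p) = ∑ p ∈ S, sndComplex (f p) :=
  map_sum (⟨⟨sndComplex, rfl⟩, sndComplex_add⟩ : ℍ →+ ℂ) f S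

theorem fstComplex_smul (x : ℝ) (q : ℍ) : fstComplex (x • q) = x * fstComplex q := by
  apply Complex.ext <;> simp [fstComplex]

theorem sndComplex_smul (x : ℝ) (q : ℍ) : sndComplex (x • q) = x * sndComplex q := by
  apply Complex.ext <;> simp [sndComplex]

theorem fstComplex_star (q : ℍ) : fstComplex (star q) = star (fstComplex q) := by
  apply Complex.ext <;> simp [fstComplex]

theorem sndComplex_star (q : ℍ) : sndComplex (star q) = -sndComplex q := by
  apply Complex.ext <;> simp [sndComplex]

theorem fstComplex_coe_mul (z : ℂ) (q : ℍ) : fstComplex (z * q) = z * fstComplex q := by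
  apply Complex.ext <;> simp [fstComplex]

theorem sndComplex_coe_mul (z : ℂ) (q : ℍ) : sndComplex (z * q) = z * sndComplex q := by
  apply Complex.ext <;> simp [sndComplex]

theorem quaternion_ext_complex {p q : ℍ} (h1 : fstComplex p = fstComplex q)
    (h2 : sndComplex p = sndComplex q) : p = q := by
  rw [← fst_add_snd_mul_j p, ← fst_add_snd_mul_j q, h1, h2]

theorem continuous_fstComplex : Continuous fstComplex :=
  Complex.equivRealProdCLM.symm.continuous.comp
    (Quaternion.continuous_re.prodMk Quaternion.continuous_imI)

theorem continuous_sndComplex : Continuous sndComplex :=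
  Complex.equivRealProdCLM.symm.continuous.comp
    (Quaternion.continuous_imJ.prodMk Quaternion.continuous_imK)

/-- The quaternion `z + w j`. -/
def ofComplexPair (z w : ℂ) : ℍ := ⟨z.re, z.im, w.re, w.im⟩

@[simp] theorem fstComplex_ofComplexPair (z w : ℂ) : fstComplex (ofComplexPair z w) = z := rfl

@[simp] theorem sndComplex_ofComplexPair (z w : ℂ) : sndComplex (ofComplexPair z w) = w := rfl

/-- The complex `2s × 2s` matrix representing the quaternionic matrix `X = X₁ + X₂ j`. -/
def complexRep {ι κ : Type*} (X : Matrix ι κ ℍ) : Matrix (ι ⊕ ι) (κ ⊕ κ) ℂ :=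
  Matrix.fromBlocks (X.map fstComplex) (X.map sndComplex)
    (-(X.map sndComplex).map star) ((X.map fstComplex).map star)

theorem complexRep_injective {ι κ : Type*} :
    Function.Injective (complexRep : Matrix ι κ ℍ → Matrix (ι ⊕ ι) (κ ⊕ κ) ℂ) := fun X Y h => by
  ext k l : 1
  exact quaternion_ext_complex (congrFun₂ h (Sum.inl k) (Sum.inl l))
    (congrFun₂ h (Sum.inl k) (Sum.inr l))

theorem complexRep_conjTranspose {ι κ : Type*} (X : Matrix ι κ ℍ) :
    complexRep Xᴴ = (complexRep X)ᴴ := by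
  rw [complexRep, complexRep, Matrix.fromBlocks_conjTranspose]
  congr 1 <;> ext k l : 1 <;> simp [fstComplex_star, sndComplex_star]

/-- The complex vector representing the quaternionic vector `c = x + y j`: the first column of its
complex representation. -/
def complexVec {ι : Type*} (c : ι → ℍ) : ι ⊕ ι → ℂ :=
  Sum.elim (fun k => fstComplex (c k)) fun k => -star (sndComplex (c k))

theorem complexVec_surjective {ι : Type*} :
    Function.Surjective (complexVec : (ι → ℍ) → ι ⊕ ι → ℂ) := fun d => by
  refine ⟨fun k => ofComplexPair (d (Sum.inl k)) (-star (d (Sum.inr k))), ?_⟩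
  ext (k | k) <;> simp [complexVec]

theorem re_star_mul_mul (p q c : ℍ) : (star p * (q * c)).re =
    (star (fstComplex p) * (fstComplex q * fstComplex c + sndComplex q * -star (sndComplex c))
      + star (-star (sndComplex p)) * (-star (sndComplex q) * fstComplex c
        + star (fstComplex q) * -star (sndComplex c))).re := by
  simp [fstComplex, sndComplex, Quaternion.re_mul, Quaternion.imI_mul, Quaternion.imJ_mul,
    Quaternion.imK_mul]
  ring

theorem re_dotProduct_mulVec {ι : Type*} [Fintype ι] (X : Matrix ι ι ℍ) (p c : ι → ℍ) :
    (star p ⬝ᵥ X *ᵥ c).re = (star (complexVec p) ⬝ᵥ complexRep X *ᵥ complexVec c).re := by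
  have hre : ∀ f : ι → ℍ, (∑ k, f k).re = ∑ k, (f k).re := fun f =>
    map_sum (⟨⟨fun q => q.re, rfl⟩, fun _ _ => rfl⟩ : ℍ →+ ℝ) f _
  simp only [dotProduct, Matrix.mulVec, Finset.mul_sum, hre, Pi.star_apply, re_star_mul_mul,
    Fintype.sum_sum_type, Complex.re_sum, mul_add, Finset.sum_add_distrib, Complex.add_re]
  simp only [complexVec, complexRep, Sum.elim_inl, Sum.elim_inr, Matrix.fromBlocks_apply₁₁,
    Matrix.fromBlocks_apply₁₂, Matrix.fromBlocks_apply₂₁, Matrix.fromBlocks_apply₂₂,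
    Matrix.map_apply, Matrix.neg_apply]
  ring

theorem re_dotProduct_blockToeplitz {s N : ℕ} (r : ℤ → Mat s) (n : Fin N → ℤ)
    (c : Fin N × Fin s → ℍ) : (star c ⬝ᵥ blockToeplitz r n *ᵥ c).re =
      (∑ j, ∑ l, star (complexVec fun k => c (j, k)) ⬝ᵥ
        complexRep (r (n j - n l)) *ᵥ complexVec fun k => c (l, k)).re := by
  have hre : ∀ f : Fin N → ℍ, (∑ k, f k).re = ∑ k, (f k).re := fun f =>
    map_sum (⟨⟨fun q => q.re, rfl⟩, fun _ _ => rfl⟩ : ℍ →+ ℝ) f _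
  simp only [Complex.re_sum, ← re_dotProduct_mulVec, ← hre]
  congr 1
  simp only [dotProduct, Matrix.mulVec, Finset.mul_sum, Fintype.sum_prod_type, blockToeplitz,
    Matrix.of_apply, Pi.star_apply]
  exact Finset.sum_congr rfl fun j _ => Finset.sum_comm

/-- Positive definiteness in terms of the complex representation. -/
theorem isPositiveDefinite_iff {s : ℕ} (r : ℤ → Mat s) : IsPositiveDefinite r ↔
    (∀ n, complexRep (r (-n)) = (complexRep (r n))ᴴ) ∧
      ∀ (N : ℕ) (n : Fin N → ℤ) (d : Fin N → Fin s ⊕ Fin s → ℂ),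
        0 ≤ (∑ j, ∑ l, star (d j) ⬝ᵥ complexRep (r (n j - n l)) *ᵥ d l).re := by
  constructor
  · refine fun h => ⟨fun n => ?_, fun N n d => ?_⟩
    · rw [← complexRep_conjTranspose]
      congr 1
      ext k l : 1
      -- The points `n` and `0` put `r n` and `r (-n)` in opposite off-diagonal blocks.
      have := (h 2 ![n, 0]).1.apply (1, k) (0, l)
      simpa [blockToeplitz] using this.symm
    · choose c hc using fun j => complexVec_surjective (d j)
      have := (h N n).2 fun p => c p.1 p.2
      rw [re_dotProduct_blockToeplitz] at this
      simpa only [hc] using this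
  · rintro ⟨h1, h2⟩ N n
    refine ⟨?_, fun c => ?_⟩
    · ext p q : 1
      have : r (n p.1 - n q.1) = (r (n q.1 - n p.1))ᴴ := complexRep_injective (by
        rw [complexRep_conjTranspose, ← h1, neg_sub])
      rw [Matrix.conjTranspose_apply, blockToeplitz, Matrix.of_apply, Matrix.of_apply, this,
        Matrix.conjTranspose_apply]
    · rw [re_dotProduct_blockToeplitz]
      exact h2 N n _

/-! ### The symmetry of complex representations -/

/-- Conjugation of the entrywise conjugate of `M` by the matrix of the quaternion unit `j`. -/
def twist {κ : Type*} (M : Matrix (κ ⊕ κ) (κ ⊕ κ) ℂ) : Matrix (κ ⊕ κ) (κ ⊕ κ) ℂ :=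
  Matrix.fromBlocks (M.toBlocks₂₂.map star) (-M.toBlocks₂₁.map star)
    (-M.toBlocks₁₂.map star) (M.toBlocks₁₁.map star)

/-- The vector `j v̄`. -/
def twistVec {κ : Type*} (v : κ ⊕ κ → ℂ) : κ ⊕ κ → ℂ :=
  Sum.elim (fun k => star (v (Sum.inr k))) fun k => -star (v (Sum.inl k))

theorem twist_complexRep {κ : Type*} (X : Matrix κ κ ℍ) : twist (complexRep X) = complexRep X := by
  rw [twist, complexRep, Matrix.toBlocks_fromBlocks₁₁, Matrix.toBlocks_fromBlocks₁₂,
    Matrix.toBlocks_fromBlocks₂₁, Matrix.toBlocks_fromBlocks₂₂]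
  congr 1 <;> ext k l : 1 <;> simp

/-- This turns the twist invariance of `R(n)` into a relation between the scalar measures at `v` and
at `twistVec v`. -/
theorem quadForm_twist {κ : Type*} [Fintype κ] (v : κ ⊕ κ → ℂ) (M : Matrix (κ ⊕ κ) (κ ⊕ κ) ℂ) :
    quadForm v (twist M) = star (quadForm (twistVec v) M) := by
  simp only [quadForm_eq_sum, Fintype.sum_sum_type, twist, twistVec, Sum.elim_inl, Sum.elim_inr,
    Matrix.fromBlocks_apply₁₁, Matrix.fromBlocks_apply₁₂, Matrix.fromBlocks_apply₂₁,
    Matrix.fromBlocks_apply₂₂, Matrix.map_apply, Matrix.neg_apply, Matrix.toBlocks₁₁,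
    Matrix.toBlocks₁₂, Matrix.toBlocks₂₁, Matrix.toBlocks₂₂, Matrix.of_apply, star_add, star_sum,
    star_mul', star_neg, star_star, Finset.sum_add_distrib]
  simp only [mul_neg, neg_mul, neg_neg, Finset.sum_neg_distrib]
  ring

/-! ### Riemann sums -/

theorem norm_coe_complex (z : ℂ) : ‖(z : ℍ)‖ = ‖z‖ := by
  have h := Quaternion.normSq_eq_norm_mul_self (z : ℍ)
  rw [Quaternion.normSq_def'] at h
  have h2 := Complex.normSq_eq_norm_sq z
  rw [Complex.normSq_apply] at h2
  simp only [Quaternion.re_coeComplex, Quaternion.imI_coeComplex, Quaternion.imJ_coeComplex,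
    Quaternion.imK_coeComplex] at h
  nlinarith [norm_nonneg z, norm_nonneg (z : ℍ)]

theorem norm_fourier_apply {T : ℝ} (n : ℤ) (t : AddCircle T) : ‖(fourier n t : ℂ)‖ = 1 := by
  rw [fourier_apply]
  exact Circle.norm_coe _

theorem norm_expInt (n : ℤ) (t : Circ) : ‖expInt n t‖ = 1 := by
  rw [expInt, norm_coe_complex, norm_fourier_apply]

theorem continuous_expInt (n : ℤ) : Continuous (expInt n) :=
  (LinearMap.continuous_of_finiteDimensional Quaternion.ofComplex.toLinearMap).comp
    (fourier n).continuous

theorem isFiniteMeasure_variation_entry {s : ℕ} (ν : QMeasure s) (k l : Fin s) :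
    IsFiniteMeasure (entry ν k l).variation := by
  -- For `n = 0` the integrand is the constant `1`, whose integrability means finite variation.
  have h := integrable_expInt ν k l 0
  have h0 : expInt 0 = fun _ => 1 := by
    funext t
    simp [expInt]
  rw [VectorMeasure.Integrable, h0, integrable_const_iff] at h
  exact h.resolve_left one_ne_zero

theorem comp_simpleFunc_eq_sum_indicator {X Y E : Type*} [MeasurableSpace X] [AddCommMonoid E]
    (φ : SimpleFunc X Y) (g : Y → E) :
    (fun t => g (φ t)) = fun t => ∑ p ∈ φ.range, (φ ⁻¹' {p}).indicator (fun _ => g p) t := by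
  classical
  funext t
  simp only [Set.indicator_apply, Set.mem_preimage, Set.mem_singleton_iff]
  rw [Finset.sum_ite_eq, if_pos (φ.mem_range_self t)]

/-- The integral of `e^{int}` is a limit of Riemann sums. -/
theorem tendsto_sum_mul_entry {s : ℕ} (ν : QMeasure s) (k l : Fin s) (n : ℤ)
    (φ : ℕ → SimpleFunc Circ Circ) (G : Circ → ℍ) (hG : ∀ t, ‖G t‖ ≤ 1)
    (hlim : ∀ t, Tendsto (fun m => G (φ m t)) atTop (𝓝 (expInt n t))) :
    Tendsto (fun m => ∑ p ∈ (φ m).range, G p * ν (φ m ⁻¹' {p}) k l) atTop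
      (𝓝 (integralExp ν n k l)) := by
  have hfin := isFiniteMeasure_variation_entry ν k l
  -- The vector-measure integral is an instance of `setToFun`; finite variation makes the constant
  -- `1` an integrable bound.
  have h := tendsto_setToFun_of_dominated_convergence
    (dominatedFinMeasAdditive_cbmApplyMeasure (entry ν k l)
      (ContinuousLinearMap.mul ℝ ℍ)) (fun _ => 1)
    (fun m => ((φ m).map G).aestronglyMeasurable) (integrable_const 1)
    (fun m => Eventually.of_forall fun t => hG _) (Eventually.of_forall hlim)
  refine h.congr fun m => ?_
  rw [SimpleFunc.coe_map, Function.comp_def, comp_simpleFunc_eq_sum_indicator, setToFun_finsetSum]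
  · refine Finset.sum_congr rfl fun p _ => ?_
    rw [setToFun_indicator_const _ ((φ m).measurableSet_fiber p) (measure_ne_top _ _)]
    rfl
  · exact fun p _ => (integrable_const _).indicator ((φ m).measurableSet_fiber p)

/-- Simple functions approximating the identity of the circle. -/
def circleApprox : ℕ → SimpleFunc Circ Circ :=
  SimpleFunc.approxOn id measurable_id Set.univ 0 (Set.mem_univ 0)

theorem tendsto_circleApprox (t : Circ) :
    Tendsto (fun m => circleApprox m t) atTop (𝓝 t) :=
  SimpleFunc.tendsto_approxOn measurable_id (Set.mem_univ 0) (by simp)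

theorem reflect_eq_preimage (A : Set Circ) : reflect A = (fun t => -t) ⁻¹' A :=
  Set.image_neg_eq_neg

theorem measurableSet_reflect {A : Set Circ} (hA : MeasurableSet A) :
    MeasurableSet (reflect A) := by
  rw [reflect_eq_preimage]
  exact measurable_neg hA

theorem tendsto_sum_entry {s : ℕ} (ν : QMeasure s) (k l : Fin s) (n : ℤ) :
    Tendsto (fun m => ∑ p ∈ (circleApprox m).range,
      expInt n p * ν (circleApprox m ⁻¹' {p}) k l) atTop (𝓝 (integralExp ν n k l)) :=
  tendsto_sum_mul_entry ν k l n circleApprox (expInt n) (fun t => (norm_expInt n t).le)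
    fun t => ((continuous_expInt n).tendsto t).comp (tendsto_circleApprox t)

theorem expInt_neg (n : ℤ) (t : Circ) : expInt n (-t) = expInt (-n) t := by
  simp [expInt]

/-- Approximating `-t` instead of `t` reflects the fibres. The lower blocks of `doubled` need this,
so that all four blocks are summed over one partition. -/
theorem tendsto_sum_entry_reflect {s : ℕ} (ν : QMeasure s) (k l : Fin s) (n : ℤ) :
    Tendsto (fun m => ∑ p ∈ (circleApprox m).range,
      expInt (-n) p * ν (reflect (circleApprox m ⁻¹' {p})) k l) atTop
        (𝓝 (integralExp ν n k l)) := by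
  have h := tendsto_sum_mul_entry ν k l n
    (fun m => (circleApprox m).comp (fun t => -t) measurable_neg) (expInt (-n))
    (fun t => (norm_expInt _ t).le) fun t => by
      have := ((continuous_expInt (-n)).tendsto (-t)).comp (tendsto_circleApprox (-t))
      rwa [expInt_neg, neg_neg] at this
  refine h.congr fun m => ?_
  have hr : ((circleApprox m).comp (fun t => -t) measurable_neg).range
      = (circleApprox m).range := by
    ext p
    simp only [SimpleFunc.mem_range, SimpleFunc.coe_comp]
    rw [neg_surjective.range_comp]
  rw [hr]
  refine Finset.sum_congr rfl fun p _ => ?_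
  rw [reflect_eq_preimage]
  rfl

/-- In the lower blocks, conjugation turns `n` into `-n` and reflection turns it back. Antisymmetry
is needed only to write `ν₂*` as a reflected conjugate in the lower left block. -/
theorem tendsto_sum_doubled {s : ℕ} {ν : QMeasure s}
    (hν : ∀ A : Set Circ, MeasurableSet A → sndPart ν A = -(sndPart ν (reflect A))ᵀ) (n : ℤ) :
    Tendsto (fun m => ∑ p ∈ (circleApprox m).range,
      (fourier n p : ℂ) • doubled ν (circleApprox m ⁻¹' {p})) atTop
        (𝓝 (complexRep (integralExp ν n))) := by
  have hstar : ∀ p : Circ, star (fourier (-n) p : ℂ) = fourier n p := fun p => by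
    rw [fourier_neg, Complex.star_def, Complex.conj_conj]
  refine tendsto_pi_nhds.2 fun a => tendsto_pi_nhds.2 fun b => ?_
  rcases a with k | k <;> rcases b with l | l
  · refine ((continuous_fstComplex.tendsto _).comp (tendsto_sum_entry ν k l n)).congr fun m => ?_
    simp [fstComplex_sum, Matrix.sum_apply, expInt, fstComplex_coe_mul, doubled, fstPart, -fourier_apply]
  · refine ((continuous_sndComplex.tendsto _).comp (tendsto_sum_entry ν k l n)).congr fun m => ?_
    simp [sndComplex_sum, Matrix.sum_apply, expInt, sndComplex_coe_mul, doubled, sndPart, -fourier_apply]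
  · refine (((continuous_sndComplex.tendsto _).comp
      (tendsto_sum_entry_reflect ν k l n)).star.neg).congr fun m => ?_
    simp only [Function.comp_apply, sndComplex_sum, Matrix.sum_apply, star_sum, ← Finset.sum_neg_distrib]
    refine Finset.sum_congr rfl fun p _ => ?_
    have := congrFun₂ (hν _ ((circleApprox m).measurableSet_fiber p)) l k
    rw [expInt, sndComplex_coe_mul, star_mul', hstar, Matrix.smul_apply, doubled,
      Matrix.fromBlocks_apply₂₁, Matrix.conjTranspose_apply, this]
    simp [sndPart, -fourier_apply]
  · refine (((continuous_fstComplex.tendsto _).comp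
      (tendsto_sum_entry_reflect ν k l n)).star).congr fun m => ?_
    simp only [Function.comp_apply, fstComplex_sum, Matrix.sum_apply, star_sum]
    refine Finset.sum_congr rfl fun p _ => ?_
    rw [expInt, fstComplex_coe_mul, star_mul', hstar]
    simp [doubled, fstPart, -fourier_apply]

/-! ### The scalar measures of a q-positive measure -/

/-- The part of `doubled` which depends on `ν A`. -/
def doubledFst (s : ℕ) : Mat s →+ Matrix (Fin s ⊕ Fin s) (Fin s ⊕ Fin s) ℂ where
  toFun X := Matrix.fromBlocks (X.map fstComplex) (X.map sndComplex) (X.map sndComplex)ᴴ 0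
  map_zero' := by ext (k | k) (l | l) <;> simp
  map_add' X Y := by ext (k | k) (l | l) : 1 <;> simp [fstComplex_add, sndComplex_add]

/-- The part of `doubled` which depends on `ν (reflect A)`. -/
def doubledSnd (s : ℕ) : Mat s →+ Matrix (Fin s ⊕ Fin s) (Fin s ⊕ Fin s) ℂ where
  toFun X := Matrix.fromBlocks 0 0 0 ((X.map fstComplex).map star)
  map_zero' := by ext (k | k) (l | l) <;> simp
  map_add' X Y := by ext (k | k) (l | l) : 1 <;> simp [fstComplex_add]

theorem continuous_doubledFst (s : ℕ) : Continuous (doubledFst s) :=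
  Continuous.matrix_fromBlocks (continuous_id.matrix_map continuous_fstComplex)
    (continuous_id.matrix_map continuous_sndComplex)
    (continuous_id.matrix_map continuous_sndComplex).matrix_conjTranspose continuous_const

theorem continuous_doubledSnd (s : ℕ) : Continuous (doubledSnd s) :=
  Continuous.matrix_fromBlocks continuous_const continuous_const continuous_const
    ((continuous_id.matrix_map continuous_fstComplex).matrix_map continuous_star)

theorem doubledFst_add_doubledSnd {s : ℕ} (ν : QMeasure s) (A : Set Circ) :
    doubledFst s (ν A) + doubledSnd s (ν (reflect A)) = doubled ν A := by
  simp [doubledFst, doubledSnd, doubled, fstPart, sndPart, Matrix.fromBlocks_add]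

theorem continuous_quadForm {ι : Type*} [Fintype ι] (v : ι → ℂ) : Continuous (quadForm v) :=
  continuous_const.dotProduct (continuous_id.matrix_mulVec continuous_const)

/-- The signed measure `A ↦ v* μ(A) v`, where `μ` is the doubled measure. -/
def quadSigned {s : ℕ} (ν : QMeasure s) (v : Fin s ⊕ Fin s → ℂ) : SignedMeasure Circ :=
  ((ν.mapRange (doubledFst s) (continuous_doubledFst s)) +
    ((ν.map fun t => -t).mapRange (doubledSnd s) (continuous_doubledSnd s))).mapRange
    (Complex.reCLM.toLinearMap.toAddMonoidHom.comp (quadForm v).toAddMonoidHom)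
    (Complex.continuous_re.comp (continuous_quadForm v))

theorem quadSigned_apply {s : ℕ} (ν : QMeasure s) (v : Fin s ⊕ Fin s → ℂ) {A : Set Circ}
    (hA : MeasurableSet A) : quadSigned ν v A = (quadForm v (doubled ν A)).re := by
  rw [← doubledFst_add_doubledSnd, reflect_eq_preimage, ← VectorMeasure.map_apply ν measurable_neg hA]
  rfl

theorem quadForm_nonneg {ι : Type*} [Fintype ι] {M : Matrix ι ι ℂ} (hM : M.PosSemidef)
    (v : ι → ℂ) : 0 ≤ quadForm v M := hM.dotProduct_mulVec_nonneg v

theorem exists_measure_quadForm {s : ℕ} {ν : QMeasure s} (hν : QPositive ν)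
    (v : Fin s ⊕ Fin s → ℂ) : ∃ μ : Measure Circ, IsFiniteMeasure μ ∧
      (∀ A, MeasurableSet A → (μ.real A : ℂ) = quadForm v (doubled ν A)) ∧
      ∀ n : ℤ, ∫ t, fourier n t ∂μ = quadForm v (complexRep (integralExp ν n)) := by
  have h0 : 0 ≤[Set.univ] quadSigned ν v := by
    rw [VectorMeasure.le_restrict_univ_iff_le, VectorMeasure.le_iff]
    intro A hA
    rw [quadSigned_apply ν v hA]
    exact (Complex.nonneg_iff.1 (quadForm_nonneg (hν.posSemidef A hA) v)).1
  let μ := (quadSigned ν v).toMeasureOfZeroLE Set.univ MeasurableSet.univ h0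
  have hμ : ∀ A, MeasurableSet A → (μ.real A : ℂ) = quadForm v (doubled ν A) := fun A hA => by
    rw [SignedMeasure.toMeasureOfZeroLE_real_apply _ h0 MeasurableSet.univ hA, Set.univ_inter,
      quadSigned_apply ν v hA]
    exact Complex.ext rfl (Complex.nonneg_iff.1 (quadForm_nonneg (hν.posSemidef A hA) v)).2
  refine ⟨μ, inferInstance, hμ, fun n => ?_⟩
  -- The step functions are those of `tendsto_sum_doubled`, so both limits are limits of the same
  -- sums.
  have h1 : Tendsto (fun m => ∫ t, fourier n (circleApprox m t) ∂μ) atTop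
      (𝓝 (∫ t, fourier n t ∂μ)) :=
    tendsto_integral_of_dominated_convergence (fun _ => 1)
      (fun m => ((circleApprox m).map (fourier n)).aestronglyMeasurable) (integrable_const 1)
      (fun m => Eventually.of_forall fun t => (norm_fourier_apply n _).le)
      (Eventually.of_forall fun t => ((fourier n).continuous.tendsto t).comp
        (tendsto_circleApprox t))
  refine tendsto_nhds_unique h1 ((((continuous_quadForm v).tendsto _).comp
    (tendsto_sum_doubled hν.antisymm n)).congr fun m => ?_)
  rw [comp_simpleFunc_eq_sum_indicator, integral_finsetSum _ fun p _ =>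
    (integrable_const _).indicator ((circleApprox m).measurableSet_fiber p),
    Function.comp_apply, map_sum]
  refine Finset.sum_congr rfl fun p _ => ?_
  have hp := (circleApprox m).measurableSet_fiber p
  rw [integral_indicator_const _ hp, map_smul, ← hμ _ hp, Complex.real_smul, smul_eq_mul, mul_comm]

/-! ### Sequences represented by q-positive measures -/

instance fact_zero_lt_two_mul_pi : Fact (0 < 2 * Real.pi) := ⟨Real.two_pi_pos⟩

theorem isPositiveDefinite_integralExp {s : ℕ} {ν : QMeasure s} (hν : QPositive ν) :
    IsPositiveDefinite (integralExp ν) := by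
  rw [isPositiveDefinite_iff]
  have hD : ∀ m p, (doubled ν (circleApprox m ⁻¹' {p})).PosSemidef := fun m p =>
    hν.posSemidef _ ((circleApprox m).measurableSet_fiber p)
  refine ⟨fun n => ?_, fun N n d => ?_⟩
  · refine tendsto_nhds_unique (tendsto_sum_doubled hν.antisymm (-n))
      (((continuous_id.matrix_conjTranspose.tendsto _).comp
        (tendsto_sum_doubled hν.antisymm n)).congr fun m => ?_)
    simp only [Function.comp_apply, id, Matrix.conjTranspose_sum, Matrix.conjTranspose_smul,
      (hD m _).isHermitian.eq]
    exact Finset.sum_congr rfl fun p _ => by rw [fourier_neg, Complex.star_def]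
  · have hlim : Tendsto (fun m => (∑ j, ∑ l, star (d j) ⬝ᵥ (∑ p ∈ (circleApprox m).range,
        (fourier (n j - n l) p : ℂ) • doubled ν (circleApprox m ⁻¹' {p})) *ᵥ d l).re) atTop
        (𝓝 (∑ j, ∑ l, star (d j) ⬝ᵥ complexRep (integralExp ν (n j - n l)) *ᵥ d l).re) := by
      refine (Complex.continuous_re.tendsto _).comp (tendsto_finsetSum _ fun j _ =>
        tendsto_finsetSum _ fun l _ => ?_)
      exact (Continuous.tendsto (f := fun X => star (d j) ⬝ᵥ X *ᵥ d l)
        (continuous_const.dotProduct (continuous_id.matrix_mulVec continuous_const)) _).comp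
        (tendsto_sum_doubled hν.antisymm (n j - n l))
    refine ge_of_tendsto' hlim fun m => ?_
    -- Since the character at `n j - n l` factors, each fibre contributes one form, at the vector `∑
    -- j, e_{-n_j}(p) d_j`.
    have key : ∑ j, ∑ l, star (d j) ⬝ᵥ (∑ p ∈ (circleApprox m).range,
        (fourier (n j - n l) p : ℂ) • doubled ν (circleApprox m ⁻¹' {p})) *ᵥ d l
        = ∑ p ∈ (circleApprox m).range, quadForm (∑ j, (fourier (-n j) p : ℂ) • d j)
          (doubled ν (circleApprox m ⁻¹' {p})) := by
      simp only [quadForm_apply, star_sum, sum_dotProduct, Matrix.mulVec_sum, dotProduct_sum,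
        Matrix.sum_mulVec, star_smul, smul_dotProduct, Matrix.mulVec_smul, dotProduct_smul,
        Matrix.smul_mulVec, smul_eq_mul, Finset.mul_sum]
      refine (Finset.sum_congr rfl fun j _ => Finset.sum_comm).trans ?_
      rw [Finset.sum_comm]
      refine Finset.sum_congr rfl fun p _ => ?_
      rw [Finset.sum_comm]
      refine Finset.sum_congr rfl fun j _ => Finset.sum_congr rfl fun l _ => ?_
      rw [sub_eq_add_neg, fourier_add, fourier_neg, fourier_neg, Complex.star_def, Complex.conj_conj]
      ring
    rw [key, Complex.re_sum]
    exact Finset.sum_nonneg fun p _ => (Complex.nonneg_iff.1 (quadForm_nonneg (hD m p) _)).1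

/-! ### Uniqueness of the representing measure -/

theorem doubled_injective {s : ℕ} {ν ν' : QMeasure s} {A : Set Circ}
    (h : doubled ν A = doubled ν' A) : ν A = ν' A := by
  ext k l : 1
  exact quaternion_ext_complex (congrFun₂ h (Sum.inl k) (Sum.inl l))
    (congrFun₂ h (Sum.inl k) (Sum.inr l))

theorem QPositive.ext {s : ℕ} {ν ν' : QMeasure s} (hν : QPositive ν) (hν' : QPositive ν')
    (h : ∀ n, integralExp ν n = integralExp ν' n) : ν = ν' := by
  refine VectorMeasure.ext fun A hA => doubled_injective (ext_quadForm fun v => ?_)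
  obtain ⟨μ, _, hμ, hf⟩ := exists_measure_quadForm hν v
  obtain ⟨μ', _, hμ', hf'⟩ := exists_measure_quadForm hν' v
  rw [← hμ A hA, ← hμ' A hA, measureReal_eq_of_fourier μ μ' fun n => by rw [hf, hf', h]]

/-! ### Existence of the representing measure -/

/-- For a positive definite sequence `r`, every form `v* χ(r(n)) v` is the sequence of Fourier
coefficients of a finite measure. -/
theorem IsPositiveDefinite.exists_measure {s : ℕ} {r : ℤ → Mat s} (hr : IsPositiveDefinite r)
    (v : Fin s ⊕ Fin s → ℂ) : ∃ μ : Measure Circ, IsFiniteMeasure μ ∧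
      ∀ n : ℤ, ∫ t, fourier n t ∂μ = quadForm v (complexRep (r n)) := by
  obtain ⟨h1, h2⟩ := (isPositiveDefinite_iff r).1 hr
  refine exists_measure_integral_fourier_eq _ (fun n => ?_) fun N c => ?_
  · rw [h1, quadForm_conjTranspose]
  · refine (h2 N (fun j => j) fun j => c j • v).trans_eq ?_
    congr 1
    refine Finset.sum_congr rfl fun j _ => Finset.sum_congr rfl fun l _ => ?_
    rw [quadForm_apply, star_smul, smul_dotProduct, Matrix.mulVec_smul, dotProduct_smul,
      smul_eq_mul, smul_eq_mul]
    ring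

section Existence

variable {s : ℕ} (μ : (Fin s ⊕ Fin s → ℂ) → Measure Circ)

/-- The complex matrix measure obtained by polarization of a family of finite measures. -/
def polarMeasure (A : Set Circ) : Matrix (Fin s ⊕ Fin s) (Fin s ⊕ Fin s) ℂ :=
  polarize fun v => ((μ v).real A : ℂ)

/-- The matrix measure `A ↦ m(A) C`. -/
def constMatrixMeasure (m : Measure Circ) [IsFiniteMeasure m] (C : Mat s) : QMeasure s :=
  m.toSignedMeasure.mapRange ⟨⟨fun x => x • C, zero_smul ℝ C⟩, fun x y => add_smul x y C⟩
    (continuous_id.smul continuous_const)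

theorem constMatrixMeasure_apply (m : Measure Circ) [IsFiniteMeasure m] (C : Mat s) {A : Set Circ}
    (hA : MeasurableSet A) : constMatrixMeasure m C A = m.real A • C := by
  rw [← Measure.toSignedMeasure_apply_measurable hA]
  rfl

/-- The quaternionic matrix measure whose complex parts are the upper blocks of
`polarMeasure μ`. -/
def quaternionMeasure [∀ v, IsFiniteMeasure (μ v)] : QMeasure s :=
  -- Each polarization term is a real measure times a constant matrix, so countable additivity is
  -- inherited.
  ∑ k, ∑ l, ∑ i,
    (constMatrixMeasure (μ (polarVector (Sum.inl k) (Sum.inl l) i))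
      (Matrix.single k l (ofComplexPair (polarCoeff i) 0))
    + constMatrixMeasure (μ (polarVector (Sum.inl k) (Sum.inr l) i))
      (Matrix.single k l (ofComplexPair 0 (polarCoeff i))))

theorem quaternionMeasure_apply [∀ v, IsFiniteMeasure (μ v)] {A : Set Circ}
    (hA : MeasurableSet A) (k l : Fin s) : quaternionMeasure μ A k l =
      ofComplexPair (polarMeasure μ A (Sum.inl k) (Sum.inl l))
        (polarMeasure μ A (Sum.inl k) (Sum.inr l)) := by
  have hsum : ∀ {ι : Type} (S : Finset ι) (f : ι → QMeasure s),
      (∑ i ∈ S, f i) A = ∑ i ∈ S, f i A := fun S f =>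
    map_sum (⟨⟨fun m => m A, rfl⟩, fun _ _ => rfl⟩ : QMeasure s →+ Mat s) f S
  simp only [quaternionMeasure, hsum, add_apply, constMatrixMeasure_apply _ _ hA,
    Matrix.sum_apply, Matrix.add_apply, Matrix.smul_apply, Matrix.single_apply]
  rw [Finset.sum_eq_single k, Finset.sum_eq_single l]
  · apply quaternion_ext_complex
    · simp [fstComplex_sum, fstComplex_add, fstComplex_smul, polarMeasure, polarize, mul_comm]
    · simp [sndComplex_sum, sndComplex_add, sndComplex_smul, polarMeasure, polarize, mul_comm]
  · intro b _ hb
    simp [hb]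
  · simp
  · intro b _ hb
    simp [hb]
  · simp

variable {μ} [∀ v, IsFiniteMeasure (μ v)] {R : ℤ → Matrix (Fin s ⊕ Fin s) (Fin s ⊕ Fin s) ℂ}

/-- The family `μ v` is not assumed quadratic in `v`, but its Fourier coefficients are, and they
determine complex combinations of finite measures. -/
theorem quadForm_polarMeasure (hμ : ∀ v n, ∫ t, fourier n t ∂(μ v) = quadForm v (R n))
    (v : Fin s ⊕ Fin s → ℂ) (A : Set Circ) :
    quadForm v (polarMeasure μ A) = ((μ v).real A : ℂ) := by
  -- The index `none` carries `-μ v`, the others the expanded polarization terms.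
  let w : Option ((Fin s ⊕ Fin s) × (Fin s ⊕ Fin s) × Fin 4) → Fin s ⊕ Fin s → ℂ := fun o =>
    o.elim v fun q => polarVector q.1 q.2.1 q.2.2
  let c : Option ((Fin s ⊕ Fin s) × (Fin s ⊕ Fin s) × Fin 4) → ℂ := fun o =>
    o.elim (-1) fun q => star (v q.1) * v q.2.1 * polarCoeff q.2.2
  have hc : ∀ f : (Fin s ⊕ Fin s → ℂ) → ℂ,
      ∑ o, c o * f (w o) = quadForm v (polarize f) - f v := fun f => by
    rw [Fintype.sum_option, quadForm_eq_sum]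
    simp only [c, w, Option.elim, Fintype.sum_prod_type, polarize, Matrix.of_apply, Finset.mul_sum,
      mul_assoc]
    ring
  have h := sum_mul_measureReal_eq_zero_of_fourier (fun o => μ (w o)) c (fun n => by
    rw [hc fun u => ∫ t, fourier n t ∂(μ u), funext fun u => hμ u n, polarize_quadForm,
      hμ, sub_self]) A
  rw [hc fun u => ((μ u).real A : ℂ), sub_eq_zero] at h
  exact h

/-- Reflection replaces `R n` by its adjoint, conjugating the form at `v`; twist invariance
conjugates again and moves `v` to `twistVec v`. So the reflected `μ v` and `μ (twistVec v)` have
equal Fourier coefficients. -/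
theorem polarMeasure_reflect (hμ : ∀ v n, ∫ t, fourier n t ∂(μ v) = quadForm v (R n))
    (hR : ∀ n, twist (R n) = R n) (hR' : ∀ n, R (-n) = (R n)ᴴ) {A : Set Circ}
    (hA : MeasurableSet A) : polarMeasure μ (reflect A) = twist (polarMeasure μ A) := by
  refine ext_quadForm fun v => ?_
  rw [quadForm_twist, quadForm_polarMeasure hμ, quadForm_polarMeasure hμ, Complex.star_def,
    Complex.conj_ofReal, reflect_eq_preimage,
    ← map_measureReal_apply measurable_neg hA]
  rw [measureReal_eq_of_fourier (T := 2 * Real.pi) _ (μ (twistVec v)) fun n => ?_]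
  rw [integral_map_of_stronglyMeasurable measurable_neg (fourier n).continuous.stronglyMeasurable]
  have : ∀ t : Circ, (fourier n (-t) : ℂ) = fourier (-n) t := fun t => by simp
  simp_rw [this]
  rw [hμ, hμ, hR', quadForm_conjTranspose, ← hR n, quadForm_twist, star_star, hR]

/-- The upper blocks agree by construction; the lower left follows from Hermitian symmetry, the
lower right from the reflection law. -/
theorem doubled_quaternionMeasure (hμ : ∀ v n, ∫ t, fourier n t ∂(μ v) = quadForm v (R n))
    (hR : ∀ n, twist (R n) = R n) (hR' : ∀ n, R (-n) = (R n)ᴴ) {A : Set Circ}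
    (hA : MeasurableSet A) : doubled (quaternionMeasure μ) A = polarMeasure μ A := by
  have hH : (polarMeasure μ A)ᴴ = polarMeasure μ A := ext_quadForm fun v => by
    rw [quadForm_conjTranspose, quadForm_polarMeasure hμ, Complex.star_def, Complex.conj_ofReal]
  have hr := polarMeasure_reflect hμ hR hR' hA
  ext (k | k) (l | l) : 1
  · simp [doubled, fstPart, quaternionMeasure_apply μ hA]
  · simp [doubled, sndPart, quaternionMeasure_apply μ hA]
  · rw [← hH]
    simp [doubled, sndPart, quaternionMeasure_apply μ hA]
  · simp [doubled, fstPart, quaternionMeasure_apply μ (measurableSet_reflect hA), hr, twist,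
      Matrix.toBlocks₂₂]

theorem qPositive_quaternionMeasure (hμ : ∀ v n, ∫ t, fourier n t ∂(μ v) = quadForm v (R n))
    (hR : ∀ n, twist (R n) = R n) (hR' : ∀ n, R (-n) = (R n)ᴴ) :
    QPositive (quaternionMeasure μ) := by
  refine ⟨fun A hA => ?_, fun A hA => ?_⟩
  · rw [doubled_quaternionMeasure hμ hR hR' hA]
    refine posSemidef_of_quadForm fun v => ?_
    rw [quadForm_polarMeasure hμ]
    exact_mod_cast measureReal_nonneg
  · have hH : (polarMeasure μ A)ᴴ = polarMeasure μ A := ext_quadForm fun v => by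
      rw [quadForm_conjTranspose, quadForm_polarMeasure hμ, Complex.star_def, Complex.conj_ofReal]
    -- Antisymmetry combines Hermitian symmetry with the off-diagonal block of the reflection law.
    ext k l : 1
    have h1 := congrFun₂ hH (Sum.inl k) (Sum.inr l)
    have h2 := congrFun₂ (polarMeasure_reflect hμ hR hR' hA) (Sum.inl l) (Sum.inr k)
    simp only [twist, Matrix.fromBlocks_apply₁₂, Matrix.map_apply, Matrix.neg_apply,
      Matrix.toBlocks₂₁, Matrix.of_apply] at h2
    rw [Matrix.conjTranspose_apply] at h1
    simp [sndPart, quaternionMeasure_apply μ hA,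
      quaternionMeasure_apply μ (measurableSet_reflect hA), h2, ← h1]

end Existence

theorem IsPositiveDefinite.exists_represents {s : ℕ} {r : ℤ → Mat s} (hr : IsPositiveDefinite r) :
    ∃ ν : QMeasure s, Represents ν r := by
  choose μ hfin hμ using hr.exists_measure
  have hR : ∀ n, twist (complexRep (r n)) = complexRep (r n) := fun n => twist_complexRep _
  have hR' := ((isPositiveDefinite_iff r).1 hr).1
  have hν := qPositive_quaternionMeasure hμ hR hR'
  refine ⟨quaternionMeasure μ, hν, fun n => complexRep_injective (ext_quadForm fun v => ?_)⟩
  obtain ⟨μ', _, hμ', hf⟩ := exists_measure_quadForm hν v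
  -- Both measures are the form at `v` of the doubled measure, so the Fourier coefficients
  -- prescribed for `μ v` pass to `ν`.
  have : μ' = μ v := Measure.ext fun A hA => by
    rw [← ENNReal.toReal_eq_toReal_iff' (measure_ne_top _ _) (measure_ne_top _ _)]
    have h := hμ' A hA
    rw [doubled_quaternionMeasure hμ hR hR' hA, quadForm_polarMeasure hμ] at h
    exact_mod_cast h
  rw [← hf, this, hμ]

end QuaternionHerglotz

end

theorem mainTheorem2 (s : ℕ) (r : ℤ → Matrix (Fin s) (Fin s) (Quaternion ℝ)) :
    (QuaternionHerglotz.IsPositiveDefinite r ↔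
      ∃! ν : QuaternionHerglotz.QMeasure s, QuaternionHerglotz.Represents ν r) ∧
    (∀ ν : QuaternionHerglotz.QMeasure s,
      QuaternionHerglotz.Represents ν r → QuaternionHerglotz.IsPositiveDefinite r) := by
  have hback : ∀ ν : QuaternionHerglotz.QMeasure s,
      QuaternionHerglotz.Represents ν r → QuaternionHerglotz.IsPositiveDefinite r := fun ν hν => by
    rw [funext hν.2]
    exact QuaternionHerglotz.isPositiveDefinite_integralExp hν.1
  refine ⟨⟨fun hr => ?_, fun ⟨ν, hν, _⟩ => hback ν hν⟩, hback⟩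
  obtain ⟨ν, hν⟩ := hr.exists_represents
  exact ⟨ν, hν, fun ν' hν' => hν'.1.ext hν.1 fun n => by rw [← hν'.2, ← hν.2]⟩
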